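/- Let $R$ be a commutative Noetherian ring of finite Krull dimension and $M$ a finitely generated $R$-module. The ordinal length $\operatorname{len}(M)$ is the supremum of the order types of all chains of nonzero submodules of $M$, ordered by reverse inclusion (such chains are well-ordered because $M$ is Noetherian). Suppose that $M$ has binary length, that is, all coefficients in the Cantor normal form $\operatorname{len}(M)=a_d\omega^d+\dots+a_1\omega+a_0$ (with $a_i\in\mathbb N$) are $0$ or $1$. Then for all submodules $N,N'\subseteq M$: (1) $\operatorname{len}(N\cap N')=\operatorname{len}(N)\wedge\operatorname{len}(N')$, where $\alpha\wedge\beta$ denotes the ordinal whose coefficients in Cantor normal form are the minima of the corresponding coefficients of $\alpha$ and $\beta$; (2) $\operatorname{Ass}(N\cap N')=\operatorname{Ass}(N)\cap\operatorname{Ass}(N')$, where $\operatorname{Ass}$ denotes the set of associated primes. -/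

import Mathlib

universe u v

section OrdinalLength

/-- In a Noetherian module, every chain of submodules is well-ordered by reverse inclusion. -/
theorem isWellOrder_chain {R : Type u} {M : Type v} [CommRing R] [AddCommGroup M] [Module R M]
    [IsNoetherian R M] {C : Set (Submodule R M)} (hC : IsChain (· ≤ ·) C) :
    IsWellOrder C (fun A B => (B : Submodule R M) < A) where
  wf := InvImage.wf (fun A : C => (A : Submodule R M)) (wellFounded_gt (α := Submodule R M))
  trichotomous A B h₁ h₂ := by
    rcases hC.total A.2 B.2 with h | h
    · exact Subtype.ext (h.eq_of_not_lt h₂)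
    · exact Subtype.ext (h.eq_of_not_lt h₁).symm

/-- The ordinal (order type) of a chain of submodules of a Noetherian module, ordered by reverse
inclusion: larger submodules come first. -/
noncomputable def chainType {R : Type u} {M : Type v} [CommRing R] [AddCommGroup M] [Module R M]
    [IsNoetherian R M] (C : Set (Submodule R M)) (hC : IsChain (· ≤ ·) C) : Ordinal.{v} :=
  haveI := isWellOrder_chain hC
  Ordinal.type (fun A B : C => (B : Submodule R M) < A)

/-- The ordinal length of a Noetherian module: the supremum of the ordinals that arise as chains of
nonzero submodules ordered by reverse inclusion. The zero submodule is left out so that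
`M = N₀ ⊋ N₁ ⊋ ⋯ ⊋ Nₗ = 0` counts as a chain of length `l`, as for the usual length. -/
noncomputable def ordinalLength (R : Type u) (M : Type v) [CommRing R] [AddCommGroup M]
    [Module R M] [IsNoetherian R M] : Ordinal.{v} :=
  ⨆ C : {C : Set (Submodule R M) // IsChain (· ≤ ·) C ∧ (⊥ : Submodule R M) ∉ C},
    chainType C.1 C.2.1

/-- The supremum in the definition of the ordinal length is a genuine one. -/
theorem chainType_le_ordinalLength {R : Type u} {M : Type v} [CommRing R] [AddCommGroup M]
    [Module R M] [IsNoetherian R M] {C : Set (Submodule R M)} (hC : IsChain (· ≤ ·) C)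
    (h : (⊥ : Submodule R M) ∉ C) : chainType C hC ≤ ordinalLength R M :=
  Ordinal.le_iSup (fun C : {C : Set (Submodule R M) //
    IsChain (· ≤ ·) C ∧ (⊥ : Submodule R M) ∉ C} => chainType C.1 C.2.1) ⟨C, hC, h⟩

end OrdinalLength

/-- An ordinal is binary if all coefficients in its Cantor normal form are `0` or `1`. -/
def IsBinaryOrdinal (α : Ordinal.{v}) : Prop :=
  ∀ e : Ordinal.{v},
    Ordinal.CNF.coeff Ordinal.omega0 α e = 0 ∨ Ordinal.CNF.coeff Ordinal.omega0 α e = 1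

/-- The ordinal whose coefficients in Cantor normal form are the minima of the corresponding
coefficients of `α` and `β`. -/
noncomputable def coeffInf (α β : Ordinal.{v}) : Ordinal.{v} :=
  Ordinal.CNF.eval Ordinal.omega0
    (Finsupp.zipWith min (min_self 0) (Ordinal.CNF.coeff Ordinal.omega0 α)
      (Ordinal.CNF.coeff Ordinal.omega0 β))

open Ordinal

namespace Ordinal

theorem add_lt_add_of_lt_of_lt_omega0 {x x' c : Ordinal.{v}} (h : x < x') (hc : c < ω) :
    x + c < x' + c := by
  obtain ⟨n, rfl⟩ := lt_omega0.1 hc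
  induction n with
  | zero => simpa using h
  | succ n ih =>
    have := Order.succ_lt_succ (ih (natCast_lt_omega0 n))
    simpa [← add_assoc, Order.succ_eq_add_one] using this

theorem omega0_pow_pos (n : ℕ) : (0 : Ordinal.{v}) < ω ^ n :=
  pow_pos omega0_pos n

theorem omega0_pow_ne_zero (n : ℕ) : (ω : Ordinal.{v}) ^ n ≠ 0 :=
  (omega0_pow_pos n).ne'

theorem mul_add_lt_mul_of_lt {w x x' s : Ordinal.{v}} (h : x < x') (hs : s < w) :
    w * x + s < w * x' := by
  calc w * x + s < w * x + w := by gcongr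
    _ = w * Order.succ x := (mul_succ w x).symm
    _ ≤ w * x' := by gcongr; exact Order.succ_le_of_lt h

theorem div_lt_omega0_of_lt {y : Ordinal.{v}} {e : ℕ} (hy : y < ω ^ (e + 1)) : y / ω ^ e < ω := by
  rwa [← lt_mul_iff_div_lt (omega0_pow_ne_zero e), ← pow_succ]

/-- A version of the natural sum for a second argument below `ω ^ (e + 1)`: the coefficients of the
Cantor normal forms in degrees at most `e` are added. -/
noncomputable def truncNatSum : ℕ → Ordinal.{v} → Ordinal.{v} → Ordinal.{v}
  | 0, x, y => x + y
  | e + 1, x, y => ω ^ (e + 1) * (x / ω ^ (e + 1) + y / ω ^ (e + 1)) +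
      truncNatSum e (x % ω ^ (e + 1)) (y % ω ^ (e + 1))

theorem truncNatSum_lt {e : ℕ} {x y : Ordinal.{v}} (hx : x < ω ^ (e + 1)) (hy : y < ω ^ (e + 1)) :
    truncNatSum e x y < ω ^ (e + 1) := by
  induction e generalizing x y with
  | zero =>
    rw [zero_add, pow_one] at *
    exact isPrincipal_add_omega0 hx hy
  | succ e ih =>
    rw [truncNatSum, pow_succ ω (e + 1)]
    exact mul_add_lt_mul_of_lt
      (isPrincipal_add_omega0 (div_lt_omega0_of_lt hx) (div_lt_omega0_of_lt hy))
      (ih (mod_lt _ (omega0_pow_ne_zero _)) (mod_lt _ (omega0_pow_ne_zero _)))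

theorem truncNatSum_mod_lt (e : ℕ) (x y : Ordinal.{v}) :
    truncNatSum e (x % ω ^ (e + 1)) (y % ω ^ (e + 1)) < ω ^ (e + 1) :=
  truncNatSum_lt (mod_lt _ (omega0_pow_ne_zero _)) (mod_lt _ (omega0_pow_ne_zero _))

theorem div_lt_or_mod_lt {x x' : Ordinal.{v}} (h : x < x') (w : Ordinal.{v}) :
    x / w < x' / w ∨ x / w = x' / w ∧ x % w < x' % w := by
  rcases (div_le_left h.le w).lt_or_eq with h' | h'
  · exact Or.inl h'
  · refine Or.inr ⟨h', ?_⟩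
    rw [← div_add_mod x w, ← div_add_mod x' w, h'] at h
    exact (add_lt_add_iff_left _).1 h

theorem truncNatSum_lt_truncNatSum_right {e : ℕ} {x y y' : Ordinal.{v}} (h : y < y') :
    truncNatSum e x y < truncNatSum e x y' := by
  induction e generalizing x y y' with
  | zero => exact (add_lt_add_iff_left x).2 h
  | succ e ih =>
    rw [truncNatSum, truncNatSum]
    rcases div_lt_or_mod_lt h (ω ^ (e + 1)) with h' | ⟨h', h''⟩
    · exact (mul_add_lt_mul_of_lt ((add_lt_add_iff_left _).2 h')
        (truncNatSum_mod_lt e x y)).trans_le le_self_add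
    · rw [h']
      exact (add_lt_add_iff_left _).2 (ih h'')

theorem truncNatSum_lt_truncNatSum_left {e : ℕ} {x x' y : Ordinal.{v}} (h : x < x')
    (hy : y < ω ^ (e + 1)) : truncNatSum e x y < truncNatSum e x' y := by
  induction e generalizing x x' y with
  | zero => exact add_lt_add_of_lt_of_lt_omega0 h (by simpa using hy)
  | succ e ih =>
    rw [truncNatSum, truncNatSum]
    rcases div_lt_or_mod_lt h (ω ^ (e + 1)) with h' | ⟨h', h''⟩
    · exact (mul_add_lt_mul_of_lt (add_lt_add_of_lt_of_lt_omega0 h' (div_lt_omega0_of_lt hy))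
        (truncNatSum_mod_lt e x y)).trans_le le_self_add
    · rw [h']
      exact (add_lt_add_iff_left _).2 (ih h'' (mod_lt _ (omega0_pow_ne_zero _)))

theorem truncNatSum_div (e : ℕ) (x y : Ordinal.{v}) :
    truncNatSum e x y / ω ^ e = x / ω ^ e + y / ω ^ e := by
  cases e with
  | zero => simp [truncNatSum]
  | succ e =>
    rw [truncNatSum, mul_add_div _ (omega0_pow_ne_zero _),
      div_eq_zero_of_lt (truncNatSum_mod_lt e x y), add_zero]

theorem truncNatSum_zero_left (e : ℕ) (y : Ordinal.{v}) : truncNatSum e 0 y = y := by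
  induction e generalizing y with
  | zero => simp [truncNatSum]
  | succ e ih => rw [truncNatSum, zero_div, zero_mod, zero_add, ih, div_add_mod]

theorem truncNatSum_omega0_pow (e : ℕ) (y : Ordinal.{v}) :
    truncNatSum e (ω ^ e) y = ω ^ e + y := by
  cases e with
  | zero => simp [truncNatSum]
  | succ e =>
    rw [truncNatSum, div_self (omega0_pow_ne_zero _), mod_self, truncNatSum_zero_left, mul_add,
      mul_one, add_assoc, div_add_mod]

theorem add_div_omega0_pow (e : ℕ) (x y : Ordinal.{v}) :
    x / ω ^ e + y / ω ^ e ≤ (x + y) / ω ^ e := by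
  have h0 := omega0_pow_ne_zero.{v} e
  rw [← mul_le_iff_le_div h0, mul_add]
  gcongr
  · exact mul_div_le _ _
  · exact mul_div_le _ _

theorem coeff_omega0_eq (o e : Ordinal.{v}) : CNF.coeff ω o e = o / ω ^ e % ω := by
  have hω : ∀ l : Ordinal.{v}, ω ^ l ≠ 0 := fun l => (opow_pos l omega0_pos).ne'
  refine CNF.rec ω ?_ (fun o ho IH => ?_) o
  · simp
  · have hx0 : o / ω ^ log ω o ≠ 0 := (div_opow_log_pos ω ho).ne'
    have hx : o / ω ^ log ω o < ω := div_opow_log_lt o one_lt_omega0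
    have hy : o % ω ^ log ω o < ω ^ log ω o := mod_lt _ (hω _)
    have key := CNF.coeff_opow_mul_add one_lt_omega0 hx0 hx hy
    have ho' : ω ^ log ω o * (o / ω ^ log ω o) + o % ω ^ log ω o = o := div_add_mod o _
    rw [ho'] at key
    rw [key, Finsupp.add_apply, IH]
    generalize o / ω ^ log ω o = x at *
    generalize o % ω ^ log ω o = y at *
    generalize log ω o = l at *
    rw [← ho']
    rcases lt_trichotomy e l with h | rfl | h
    · rw [Finsupp.single_eq_of_ne h.ne, zero_add]
      obtain ⟨d, rfl⟩ : ∃ d, l = e + (1 + d) :=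
        ⟨l - e - 1, by
          rw [Ordinal.add_sub_cancel_of_le, Ordinal.add_sub_cancel_of_le h.le]
          rw [Order.one_le_iff_pos]
          exact lt_sub.2 (by rwa [add_zero])⟩
      rw [opow_add, opow_add, opow_one, mul_assoc, mul_add_div _ (hω e), mul_assoc,
        mul_add_mod_self]
    · rw [Finsupp.single_eq_same, mul_add_div _ (hω _), div_eq_zero_of_lt hy]
      simp [mod_eq_of_lt hx]
    · have h1 : y < ω ^ e := hy.trans ((opow_lt_opow_iff_right one_lt_omega0).2 h)
      have h2 : ω ^ l * x + y < ω ^ e := opow_mul_add_lt_opow hx hy h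
      rw [Finsupp.single_eq_of_ne h.ne', div_eq_zero_of_lt h1, div_eq_zero_of_lt h2]
      simp

end Ordinal

section IntervalRank

variable {L : Type v} [PartialOrder L] [WellFoundedGT L]

theorem isWellFounded_gt_of_le (L : Type v) [PartialOrder L] [WellFoundedGT L] (b : L) :
    IsWellFounded L (fun c a => a < c ∧ c ≤ b) :=
  ⟨Subrelation.wf (fun h => h.1) (wellFounded_gt (α := L))⟩

/-- The ordinal rank of `a` in the interval `[a, b]`, ordered by `>`. -/
noncomputable def intervalRank (a b : L) : Ordinal.{v} :=
  haveI := isWellFounded_gt_of_le L b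
  IsWellFounded.rank (fun c a => a < c ∧ c ≤ b) a

theorem intervalRank_lt {a b c : L} (h : a < c) (hc : c ≤ b) :
    intervalRank c b < intervalRank a b :=
  haveI := isWellFounded_gt_of_le L b
  IsWellFounded.rank_lt_of_rel (r := fun c a => a < c ∧ c ≤ b) ⟨h, hc⟩

theorem intervalRank_le_iff {a b : L} {o : Ordinal.{v}} :
    intervalRank a b ≤ o ↔ ∀ c, a < c → c ≤ b → intervalRank c b < o := by
  refine ⟨fun h c hc hb => (intervalRank_lt hc hb).trans_le h, fun h => ?_⟩
  have := isWellFounded_gt_of_le L b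
  rw [intervalRank, IsWellFounded.rank_eq]
  exact Ordinal.iSup_le fun c => Order.succ_le_of_lt (h c.1 c.2.1 c.2.2)

theorem intervalRank_self (a : L) : intervalRank a a = 0 :=
  nonpos_iff_eq_zero.1 (intervalRank_le_iff.2 fun _ h h' => absurd (h.trans_le h') (lt_irrefl _))

theorem exists_intervalRank_eq {a b : L} (hab : a ≤ b) {o : Ordinal.{v}}
    (h : o ≤ intervalRank a b) : ∃ c, a ≤ c ∧ c ≤ b ∧ intervalRank c b = o := by
  induction a using WellFoundedGT.induction with
  | ind a ih =>
    rcases h.eq_or_lt with rfl | h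
    · exact ⟨a, le_rfl, hab, rfl⟩
    · have := mt intervalRank_le_iff.2 h.not_ge
      push Not at this
      obtain ⟨c, hc, hcb, hoc⟩ := this
      obtain ⟨d, hd, hd'⟩ := ih c hc hcb hoc
      exact ⟨d, hc.le.trans hd, hd'⟩

theorem exists_lt_intervalRank_eq {a b : L} (hab : a ≤ b) {o : Ordinal.{v}}
    (h : o < intervalRank a b) : ∃ c, a < c ∧ c ≤ b ∧ intervalRank c b = o := by
  obtain ⟨c, hac, hcb, rfl⟩ := exists_intervalRank_eq hab h.le
  exact ⟨c, hac.lt_of_ne (by rintro rfl; exact h.false), hcb, rfl⟩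

theorem intervalRank_le_of_strictMono {a b : L} {φ : L → Ordinal.{v}}
    (h : ∀ x y, a ≤ x → x < y → y ≤ b → φ y < φ x) : intervalRank a b ≤ φ a := by
  suffices ∀ x, a ≤ x → intervalRank x b ≤ φ x from this a le_rfl
  intro x
  induction x using WellFoundedGT.induction with
  | ind x ih =>
    exact fun hx => intervalRank_le_iff.2 fun c hc hcb =>
      (ih c hc (hx.trans hc.le)).trans_lt (h x c hx hc hcb)

theorem intervalRank_le_map {L' : Type v} [PartialOrder L'] [WellFoundedGT L'] {a b : L} {b' : L'}
    (g : L → L') (h : ∀ x y, a ≤ x → x < y → y ≤ b → g x < g y ∧ g y ≤ b') :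
    intervalRank a b ≤ intervalRank (g a) b' :=
  intervalRank_le_of_strictMono (φ := fun x => intervalRank (g x) b') fun x y hx hxy hy =>
    intervalRank_lt (h x y hx hxy hy).1 (h x y hx hxy hy).2

theorem intervalRank_le_left {a a' b : L} (h : a ≤ a') :
    intervalRank a' b ≤ intervalRank a b := by
  rcases h.eq_or_lt with rfl | h
  · rfl
  · exact intervalRank_le_iff.2 fun c hc hcb => intervalRank_lt (h.trans hc) hcb

theorem intervalRank_le_right {a b b' : L} (h : b ≤ b') :
    intervalRank a b ≤ intervalRank a b' :=
  intervalRank_le_map id fun _ _ _ hxy hy => ⟨hxy, hy.trans h⟩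

theorem intervalRank_eq_zero_iff {a b : L} (hab : a ≤ b) : intervalRank a b = 0 ↔ a = b := by
  refine ⟨fun h => ?_, fun h => h ▸ intervalRank_self a⟩
  by_contra hne
  exact not_lt_zero (h ▸ intervalRank_lt (hab.lt_of_ne hne) le_rfl)

theorem intervalRank_add_le {a m b : L} (ham : a ≤ m) (hmb : m ≤ b) :
    intervalRank m b + intervalRank a m ≤ intervalRank a b := by
  induction a using WellFoundedGT.induction with
  | ind a ih =>
    rcases ham.eq_or_lt with rfl | ham
    · rw [intervalRank_self, add_zero]
    · rw [Ordinal.add_le_iff fun h => ham.ne ((intervalRank_eq_zero_iff ham.le).1 h)]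
      intro o ho
      obtain ⟨c, hac, hcm, rfl⟩ := exists_lt_intervalRank_eq ham.le ho
      exact (ih c hac hcm).trans_lt (intervalRank_lt hac (hcm.trans hmb))

/-- The coefficient of `ω ^ e` in the Cantor normal form of `intervalRank a b`. -/
noncomputable def rankCoeff (e : ℕ) (a b : L) : Ordinal.{v} :=
  intervalRank a b / ω ^ e % ω

theorem rankCoeff_eq_div {e : ℕ} {a b : L} (h : intervalRank a b < ω ^ (e + 1)) :
    rankCoeff e a b = intervalRank a b / ω ^ e :=
  mod_eq_of_lt (div_lt_omega0_of_lt h)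

theorem rankCoeff_lt_omega0 (e : ℕ) (a b : L) : rankCoeff e a b < ω :=
  mod_lt _ omega0_ne_zero

end IntervalRank

section Modular

variable {L : Type v} [Lattice L] [IsModularLattice L] [WellFoundedGT L]

theorem intervalRank_le_truncNatSum {a m b : L} (ham : a ≤ m) (hmb : m ≤ b) {e : ℕ}
    (h : intervalRank a m < ω ^ (e + 1)) :
    intervalRank a b ≤ truncNatSum e (intervalRank m b) (intervalRank a m) := by
  have key := intervalRank_le_of_strictMono (a := a) (b := b)
    (φ := fun x => truncNatSum e (intervalRank (x ⊔ m) b) (intervalRank (x ⊓ m) m)) ?_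
  · simpa [sup_eq_right.2 ham, inf_eq_left.2 ham] using key
  · intro x y hax hxy hyb
    have hbd : intervalRank (x ⊓ m) m < ω ^ (e + 1) :=
      (intervalRank_le_left (le_inf hax ham)).trans_lt h
    rcases (inf_le_inf_right m hxy.le).eq_or_lt with h1 | h1
    · have h2 : x ⊔ m < y ⊔ m := (sup_le_sup_right hxy.le m).lt_of_ne fun h2 =>
        hxy.ne (eq_of_le_of_inf_le_of_sup_le hxy.le h1.ge h2.ge)
      rw [← h1]
      exact truncNatSum_lt_truncNatSum_left (intervalRank_lt h2 (sup_le hyb hmb)) hbd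
    · refine (truncNatSum_lt_truncNatSum_right (intervalRank_lt h1 inf_le_right)).trans_le ?_
      rcases (sup_le_sup_right hxy.le m).eq_or_lt with h2 | h2
      · rw [h2]
      · exact (truncNatSum_lt_truncNatSum_left (intervalRank_lt h2 (sup_le hyb hmb)) hbd).le

theorem intervalRank_div {a m b : L} (ham : a ≤ m) (hmb : m ≤ b) {e : ℕ}
    (h : intervalRank a m < ω ^ (e + 1)) :
    intervalRank a b / ω ^ e = intervalRank m b / ω ^ e + intervalRank a m / ω ^ e := by
  apply le_antisymm
  · rw [← truncNatSum_div]
    exact div_le_left (intervalRank_le_truncNatSum ham hmb h) _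
  · exact (add_div_omega0_pow e _ _).trans (div_le_left (intervalRank_add_le ham hmb) _)

theorem intervalRank_sup_right_le (a b : L) :
    intervalRank b (a ⊔ b) ≤ intervalRank (a ⊓ b) a := by
  have := intervalRank_le_map (a := b) (b := a ⊔ b) (b' := a) (fun x => a ⊓ x) ?_
  · exact this
  · intro x y hbx hxy hy
    refine ⟨(inf_le_inf_left a hxy.le).lt_of_ne fun h => hxy.ne ?_, inf_le_left⟩
    refine eq_of_le_of_inf_le_of_sup_le (z := a) hxy.le ?_ ?_
    · rw [inf_comm y, inf_comm x]; exact h.ge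
    · exact (sup_le hy le_sup_left).trans (sup_le le_sup_right (hbx.trans le_sup_left))

theorem intervalRank_inf_left_le (a b : L) :
    intervalRank (a ⊓ b) a ≤ intervalRank b (a ⊔ b) := by
  have := intervalRank_le_map (a := a ⊓ b) (b := a) (b' := a ⊔ b) (fun x => x ⊔ b) ?_
  · simpa using this
  · intro x y hx hxy hy
    refine ⟨(sup_le_sup_right hxy.le b).lt_of_ne fun h => hxy.ne ?_, sup_le_sup_right hy b⟩
    refine eq_of_le_of_inf_le_of_sup_le (z := b) hxy.le ?_ h.ge
    exact le_inf ((inf_le_inf_right b hy).trans hx) inf_le_right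

theorem intervalRank_sup_right (a b : L) :
    intervalRank b (a ⊔ b) = intervalRank (a ⊓ b) a :=
  (intervalRank_sup_right_le a b).antisymm (intervalRank_inf_left_le a b)

theorem exists_intervalRank_lt_of_rankCoeff (e : ℕ) {a b : L} (hab : a ≤ b) :
    ∃ d, a ≤ d ∧ d ≤ b ∧ intervalRank a d < ω ^ (e + 1) ∧
      intervalRank a d / ω ^ e = rankCoeff e a b := by
  have h0 := omega0_pow_ne_zero.{v} (e + 1)
  obtain ⟨d, had, hdb, hd⟩ := exists_intervalRank_eq hab
    (mul_div_le (intervalRank a b) (ω ^ (e + 1)))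
  have hlt : intervalRank a d < ω ^ (e + 1) := by
    have h1 := intervalRank_add_le had hdb
    rw [hd] at h1
    exact ((add_le_add_iff_left _).1 (h1.trans_eq (div_add_mod _ (ω ^ (e + 1))).symm)).trans_lt (mod_lt _ h0)
  refine ⟨d, had, hdb, hlt, ?_⟩
  rw [rankCoeff, intervalRank_div had hdb hlt, hd, pow_succ, mul_assoc,
    mul_div_cancel _ (omega0_pow_ne_zero e), mul_add_mod_self,
    mod_eq_of_lt (div_lt_omega0_of_lt hlt)]

theorem le_add_mod_omega0 (x : Ordinal.{v}) {c : Ordinal.{v}} (hc : c < ω) : c ≤ (x + c) % ω := by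
  rw [← div_add_mod x ω, add_assoc, mul_add_mod_self,
    mod_eq_of_lt (isPrincipal_add_omega0 (mod_lt _ omega0_ne_zero) hc)]
  exact le_add_self

theorem rankCoeff_mono (e : ℕ) {a b c : L} (hab : a ≤ b) (hbc : b ≤ c) :
    rankCoeff e a b ≤ rankCoeff e a c := by
  obtain ⟨d, had, hdb, hlt, hd⟩ := exists_intervalRank_lt_of_rankCoeff e hab
  rw [← hd, rankCoeff, intervalRank_div had (hdb.trans hbc) hlt]
  exact le_add_mod_omega0 _ (div_lt_omega0_of_lt hlt)

theorem rankCoeff_inf_ne_zero {e : ℕ} {a b c t : L} (hab : a ≤ b) (hac : a ≤ c) (hbt : b ≤ t)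
    (hct : c ≤ t) (ht : rankCoeff e a t ≤ 1) (hb : rankCoeff e a b ≠ 0)
    (hc : rankCoeff e a c ≠ 0) : rankCoeff e a (b ⊓ c) ≠ 0 := by
  obtain ⟨d, had, hdb, hlt, hd⟩ := exists_intervalRank_lt_of_rankCoeff e hab
  obtain ⟨d', had', hdc, hlt', hd'⟩ := exists_intervalRank_lt_of_rankCoeff e hac
  have haE : a ≤ d ⊓ d' := le_inf had had'
  have hElt : intervalRank a (d ⊓ d') < ω ^ (e + 1) :=
    (intervalRank_le_right inf_le_left).trans_lt hlt
  intro h0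
  have hE : rankCoeff e a (d ⊓ d') = 0 :=
    nonpos_iff_eq_zero.1 ((rankCoeff_mono e haE (inf_le_inf hdb hdc)).trans_eq h0)
  rw [rankCoeff_eq_div hElt] at hE
  have h1 := intervalRank_div haE inf_le_left hElt
  rw [hE, add_zero] at h1
  have had'' : d' ≤ d ⊔ d' := le_sup_right
  have h2 := intervalRank_div had' had'' hlt'
  rw [intervalRank_sup_right, ← h1, hd, hd'] at h2
  have h3 : rankCoeff e a (d ⊔ d') ≤ 1 :=
    (rankCoeff_mono e (had'.trans had'') (sup_le (hdb.trans hbt) (hdc.trans hct))).trans ht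
  rw [rankCoeff, h2, mod_eq_of_lt
    (isPrincipal_add_omega0 (rankCoeff_lt_omega0 e a b) (rankCoeff_lt_omega0 e a c))] at h3
  have h4 : (1 : Ordinal.{v}) + 1 ≤ rankCoeff e a b + rankCoeff e a c :=
    add_le_add (Order.one_le_iff_pos.2 (pos_iff_ne_zero.2 hb))
      (Order.one_le_iff_pos.2 (pos_iff_ne_zero.2 hc))
  have h5 := h4.trans h3
  rw [← Order.succ_eq_add_one] at h5
  exact (Order.lt_succ (1 : Ordinal.{v})).not_ge h5

end Modular

section Chains

variable {L : Type v}

/-- There is a strictly decreasing sequence of length `α` in the half-open interval `(a, b]`. -/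
def HasDescendingChain [PartialOrder L] (a b : L) (α : Ordinal.{v}) : Prop :=
  ∃ f : Ordinal.{v} → L, (∀ o < α, a < f o ∧ f o ≤ b) ∧ ∀ o o', o < o' → o' < α → f o' < f o

theorem HasDescendingChain.zero [PartialOrder L] (a b : L) : HasDescendingChain a b 0 :=
  ⟨fun _ => a, fun _ ho => absurd ho not_lt_zero, fun _ _ _ ho => absurd ho not_lt_zero⟩

theorem HasDescendingChain.one [PartialOrder L] {a b : L} (h : a < b) :
    HasDescendingChain a b 1 := by
  refine ⟨fun _ => b, fun _ _ => ⟨h, le_rfl⟩, fun o o' h1 h2 => ?_⟩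
  rw [Order.lt_one_iff] at h2
  subst h2
  exact absurd h1 not_lt_zero

theorem HasDescendingChain.add [PartialOrder L] {a m b : L} {α β : Ordinal.{v}}
    (h : HasDescendingChain m b α) (h' : HasDescendingChain a m β) (ham : a ≤ m) (hmb : m ≤ b) :
    HasDescendingChain a b (α + β) := by
  classical
  obtain ⟨f, hf, hfa⟩ := h
  obtain ⟨g, hg, hga⟩ := h'
  have hsub : ∀ o, α ≤ o → o < α + β → o - α < β := fun o h1 h2 => by
    rwa [← add_lt_add_iff_left α, Ordinal.add_sub_cancel_of_le h1]
  refine ⟨fun o => if o < α then f o else g (o - α), fun o ho => ?_, fun o o' hoo ho' => ?_⟩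
  · dsimp only
    by_cases h1 : o < α
    · rw [if_pos h1]
      exact ⟨ham.trans_lt (hf o h1).1, (hf o h1).2⟩
    · rw [if_neg h1]
      have := hg _ (hsub o (not_lt.1 h1) ho)
      exact ⟨this.1, this.2.trans hmb⟩
  · by_cases h1 : o' < α
    · simp only [if_pos h1, if_pos (hoo.trans h1)]
      exact hfa o o' hoo h1
    · have h2 := hsub o' (not_lt.1 h1) ho'
      by_cases h3 : o < α
      · simp only [if_neg h1, if_pos h3]
        exact (hg _ h2).2.trans_lt (hf o h3).1
      · simp only [if_neg h1, if_neg h3]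
        refine hga _ _ ?_ h2
        rwa [← add_lt_add_iff_left α, Ordinal.add_sub_cancel_of_le (not_lt.1 h3),
          Ordinal.add_sub_cancel_of_le (not_lt.1 h1)]

theorem HasDescendingChain.mul_omega0 [PartialOrder L] {a b : L} {w : Ordinal.{v}} (hw : w ≠ 0)
    (c : ℕ → L) (hc : Antitone c) (hcb : c 0 ≤ b) (hac : ∀ n, a ≤ c n)
    (h : ∀ n, HasDescendingChain (c (n + 1)) (c n) w) : HasDescendingChain a b (w * ω) := by
  choose f hf hfa using h
  have hdiv : ∀ o < w * ω, ∃ k : ℕ, o / w = k := fun o ho =>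
    lt_omega0.1 ((lt_mul_iff_div_lt hw).1 ho)
  choose! k hk using hdiv
  refine ⟨fun o => f (k o) (o % w), fun o ho => ?_, fun o o' hoo ho' => ?_⟩
  · have := hf (k o) _ (mod_lt o hw)
    exact ⟨(hac _).trans_lt this.1, this.2.trans ((hc (Nat.zero_le _)).trans hcb)⟩
  · have hk1 := hk o (hoo.trans ho')
    have hk2 := hk o' ho'
    rcases div_lt_or_mod_lt hoo w with h1 | ⟨h1, h2⟩
    · rw [hk1, hk2, Nat.cast_lt] at h1
      exact (hf (k o') _ (mod_lt o' hw)).2.trans_lt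
        ((hc h1).trans_lt (hf (k o) _ (mod_lt o hw)).1)
    · rw [hk1, hk2, Nat.cast_inj] at h1
      dsimp only
      rw [← h1]
      exact hfa (k o) _ _ h2 (mod_lt o' hw)

variable [Lattice L] [IsModularLattice L] [WellFoundedGT L]

theorem exists_lt_intervalRank_eq_omega0_pow {a b : L} (hab : a ≤ b) {n : ℕ}
    (h : ω ^ (n + 1) ≤ intervalRank a b) :
    ∃ c, a ≤ c ∧ c ≤ b ∧ intervalRank c b = ω ^ n ∧ ω ^ (n + 1) ≤ intervalRank a c := by
  have hlt : (ω : Ordinal.{v}) ^ n < ω ^ (n + 1) :=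
    pow_lt_pow_right₀ one_lt_omega0 (Nat.lt_succ_self n)
  obtain ⟨c, hac, hcb, hc⟩ := exists_intervalRank_eq hab (hlt.le.trans h)
  refine ⟨c, hac, hcb, hc, ?_⟩
  by_contra! hlt'
  exact (h.trans (intervalRank_le_truncNatSum hac hcb hlt')).not_gt
    (truncNatSum_lt (hc ▸ hlt) hlt')

theorem hasDescendingChain_omega0_pow {a b : L} (hab : a ≤ b) {n : ℕ}
    (h : ω ^ n ≤ intervalRank a b) : HasDescendingChain a b (ω ^ n) := by
  induction n generalizing a b with
  | zero =>
    rw [pow_zero] at *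
    refine HasDescendingChain.one (hab.lt_of_ne fun h' => ?_)
    rw [h', intervalRank_self] at h
    exact zero_lt_one.not_ge h
  | succ n ih =>
    let S := {c : L // a ≤ c ∧ c ≤ b ∧ ω ^ (n + 1) ≤ intervalRank a c}
    have hstep : ∀ s : S, ∃ t : S, t.1 ≤ s.1 ∧ intervalRank t.1 s.1 = ω ^ n := fun s => by
      obtain ⟨c, h1, h2, h3, h4⟩ := exists_lt_intervalRank_eq_omega0_pow s.2.1 s.2.2.2
      exact ⟨⟨c, h1, h2.trans s.2.2.1, h4⟩, h2, h3⟩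
    choose next hnext hrank using hstep
    let c : ℕ → S := fun k => next^[k] ⟨b, hab, le_rfl, h⟩
    have hc : ∀ k, c (k + 1) = next (c k) := fun k => Function.iterate_succ_apply' next k _
    rw [pow_succ]
    refine HasDescendingChain.mul_omega0 (omega0_pow_ne_zero n) (fun k => (c k).1)
      (antitone_nat_of_succ_le fun k => ?_) (c 0).2.2.1 (fun k => (c k).2.1) fun k => ?_
    · rw [hc]
      exact hnext _
    · rw [hc]
      exact ih (hnext _) (hrank _).ge

theorem hasDescendingChain_intervalRank {a b : L} (hab : a ≤ b) {n : ℕ}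
    (h : intervalRank a b < ω ^ n) : HasDescendingChain a b (intervalRank a b) := by
  generalize hα : intervalRank a b = α at *
  induction α using WellFoundedLT.induction generalizing a b with
  | ind α ih =>
    rcases eq_or_ne α 0 with rfl | hα0
    · exact HasDescendingChain.zero a b
    obtain ⟨e, he, hlt⟩ : ∃ e : ℕ, ω ^ e ≤ α ∧ α < ω ^ (e + 1) := by
      classical
      have hex : ∃ k : ℕ, α < ω ^ k := ⟨n, h⟩
      have hpos : Nat.find hex ≠ 0 := fun h0 => by
        have := Nat.find_spec hex
        rw [h0, pow_zero, Order.lt_one_iff] at this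
        exact hα0 this
      obtain ⟨e, he⟩ := Nat.exists_eq_succ_of_ne_zero hpos
      refine ⟨e, not_lt.1 (Nat.find_min hex (he ▸ Nat.lt_succ_self e)), ?_⟩
      exact Nat.succ_eq_add_one e ▸ he ▸ Nat.find_spec hex
    obtain ⟨c, hac, hcb, hc⟩ := exists_intervalRank_eq hab (he.trans_eq hα.symm)
    obtain ⟨β, rfl⟩ : ∃ β, α = ω ^ e + β := ⟨α - ω ^ e, (Ordinal.add_sub_cancel_of_le he).symm⟩
    have h1 : intervalRank a c ≤ β := by
      have := intervalRank_add_le hac hcb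
      rw [hc, hα] at this
      exact (add_le_add_iff_left _).1 this
    have hβ : β < ω ^ (e + 1) := le_add_self.trans_lt hlt
    have h2 := intervalRank_le_truncNatSum hac hcb (h1.trans_lt hβ)
    rw [hα, hc, truncNatSum_omega0_pow] at h2
    have h3 : intervalRank a c = β := h1.antisymm ((add_le_add_iff_left _).1 h2)
    have hβlt : β < ω ^ e + β := by
      have := truncNatSum_lt_truncNatSum_left (omega0_pow_pos e) hβ
      rwa [truncNatSum_zero_left, truncNatSum_omega0_pow] at this
    exact (hasDescendingChain_omega0_pow hcb hc.ge).add
      (ih β hβlt hac h3 (hβlt.trans h)) hac hcb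

end Chains

section OrdinalLength

variable {R : Type u} {M : Type v} [CommRing R] [AddCommGroup M] [Module R M] [IsNoetherian R M]

theorem chainType_le_intervalRank {C : Set (Submodule R M)} (hC : IsChain (· ≤ ·) C)
    (h : (⊥ : Submodule R M) ∉ C) : chainType C hC ≤ intervalRank (⊥ : Submodule R M) ⊤ := by
  have := isWellOrder_chain hC
  let r : C → C → Prop := fun A B => (B : Submodule R M) < A
  change Ordinal.type r ≤ _
  have key : ∀ A : C, typein r A ≤ intervalRank A.1 ⊤ := fun A => by
    induction A using (isWellOrder_chain hC).wf.induction with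
    | _ A ih =>
      refine le_of_forall_lt fun o ho => ?_
      obtain ⟨B, rfl⟩ := typein_surj r (ho.trans (typein_lt_type r A))
      have hBA : r B A := (typein_lt_typein r).1 ho
      exact (ih B hBA).trans_lt (intervalRank_lt hBA le_top)
  refine le_of_forall_lt fun o ho => ?_
  obtain ⟨A, rfl⟩ := typein_surj r ho
  refine (key A).trans_lt (intervalRank_lt (bot_lt_iff_ne_bot.2 fun h0 => h ?_) le_top)
  rw [← h0]
  exact A.2

theorem HasDescendingChain.le_ordinalLength {α : Ordinal.{v}}
    (h : HasDescendingChain (⊥ : Submodule R M) ⊤ α) : α ≤ ordinalLength R M := by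
  obtain ⟨f, hf, hfa⟩ := h
  let C : Set (Submodule R M) := f '' Set.Iio α
  have hC : IsChain (· ≤ ·) C := by
    rintro _ ⟨o, ho, rfl⟩ _ ⟨o', ho', rfl⟩ hne
    rcases lt_trichotomy o o' with h | rfl | h
    · exact Or.inr (hfa _ _ h ho').le
    · exact absurd rfl hne
    · exact Or.inl (hfa _ _ h ho).le
  have hbot : (⊥ : Submodule R M) ∉ C := by
    rintro ⟨o, ho, h0⟩
    exact (hf o ho).1.ne' h0
  refine le_trans ?_ (chainType_le_ordinalLength hC hbot)
  have := isWellOrder_chain hC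
  let r : C → C → Prop := fun A B => (B : Submodule R M) < A
  change _ ≤ Ordinal.type r
  have key : ∀ o (ho : o < α), o ≤ typein r ⟨f o, o, ho, rfl⟩ := fun o => by
    induction o using WellFoundedLT.induction with
    | ind o ih =>
      intro ho
      refine le_of_forall_lt fun o' ho' => (ih o' ho' (ho'.trans ho)).trans_lt ?_
      exact (typein_lt_typein r).2 (hfa _ _ ho' ho)
  exact le_of_forall_lt fun o ho => (key o ho).trans_lt (typein_lt_type r _)

theorem ordinalLength_eq_intervalRank {n : ℕ}
    (h : intervalRank (⊥ : Submodule R M) ⊤ < ω ^ n) :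
    ordinalLength R M = intervalRank (⊥ : Submodule R M) ⊤ :=
  le_antisymm (Ordinal.iSup_le fun C => chainType_le_intervalRank C.2.1 C.2.2)
    (hasDescendingChain_intervalRank le_top h).le_ordinalLength

end OrdinalLength

section Modules

variable {R : Type u} [CommRing R]

theorem intervalRank_ker_eq_range {X Y : Type v} [AddCommGroup X] [AddCommGroup Y] [Module R X]
    [Module R Y] [IsNoetherian R X] [IsNoetherian R Y] (f : X →ₗ[R] Y) :
    intervalRank (LinearMap.ker f) ⊤ = intervalRank ⊥ (LinearMap.range f) := by
  apply le_antisymm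
  · have := intervalRank_le_map (a := LinearMap.ker f) (b := ⊤) (b' := LinearMap.range f)
      (fun x => x.map f) fun x y hx hxy _ => ⟨(Submodule.map_mono hxy.le).lt_of_ne fun h => ?_,
        LinearMap.map_le_range⟩
    · rwa [show (LinearMap.ker f).map f = ⊥ from
        eq_bot_iff.2 (by rintro _ ⟨x, hx, rfl⟩; exact hx)] at this
    · apply hxy.ne
      rw [← Submodule.comap_map_eq_self hx, ← Submodule.comap_map_eq_self (hx.trans hxy.le), h]
  · refine intervalRank_le_map (a := (⊥ : Submodule R Y)) (b := LinearMap.range f) (b' := ⊤)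
      (fun x => x.comap f) fun x y hx hxy hy =>
        ⟨(Submodule.comap_mono hxy.le).lt_of_ne fun h => hxy.ne ?_, le_top⟩
    rw [← Submodule.map_comap_eq_of_le (hxy.le.trans hy), h, Submodule.map_comap_eq_of_le hy]

theorem intervalRank_bot_subtype {M : Type v} [AddCommGroup M] [Module R M] [IsNoetherian R M]
    (N : Submodule R M) :
    intervalRank (⊥ : Submodule R N) ⊤ = intervalRank ⊥ N := by
  simpa using intervalRank_ker_eq_range N.subtype

theorem intervalRank_quotient {M : Type v} [AddCommGroup M] [Module R M] [IsNoetherian R M]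
    (N : Submodule R M) :
    intervalRank N ⊤ = intervalRank (⊥ : Submodule R (M ⧸ N)) ⊤ := by
  simpa using intervalRank_ker_eq_range N.mkQ

theorem LinearEquiv.intervalRank_eq {X Y : Type v} [AddCommGroup X] [AddCommGroup Y] [Module R X]
    [Module R Y] [IsNoetherian R X] [IsNoetherian R Y] (f : X ≃ₗ[R] Y) :
    intervalRank (⊥ : Submodule R X) ⊤ = intervalRank (⊥ : Submodule R Y) ⊤ := by
  simpa using intervalRank_ker_eq_range (f : X →ₗ[R] Y)

theorem intervalRank_lt_of_exact {X Y Z : Type v} [AddCommGroup X] [AddCommGroup Y]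
    [AddCommGroup Z] [Module R X] [Module R Y] [Module R Z] [IsNoetherian R X] [IsNoetherian R Y]
    [IsNoetherian R Z] {f : X →ₗ[R] Y} {g : Y →ₗ[R] Z} (hf : Function.Injective f)
    (hg : Function.Surjective g) (hfg : Function.Exact f g) {e : ℕ}
    (hX : intervalRank (⊥ : Submodule R X) ⊤ < ω ^ (e + 1))
    (hZ : intervalRank (⊥ : Submodule R Z) ⊤ < ω ^ (e + 1)) :
    intervalRank (⊥ : Submodule R Y) ⊤ < ω ^ (e + 1) := by
  have h1 := intervalRank_ker_eq_range f
  have h2 := intervalRank_ker_eq_range g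
  rw [LinearMap.ker_eq_bot.2 hf] at h1
  rw [LinearMap.range_eq_top.2 hg, hfg.linearMap_ker_eq] at h2
  rw [h1] at hX
  rw [← h2] at hZ
  exact (intervalRank_le_truncNatSum bot_le le_top hX).trans_lt (truncNatSum_lt hZ hX)

variable [IsNoetherianRing R]

theorem intervalRank_lt_of_forall_prime {n : ℕ} (I : Ideal R)
    (h : ∀ (X : Type v) [AddCommGroup X] [Module R X] [Module.Finite R X] (q : PrimeSpectrum R),
      I ≤ q.asIdeal → (X ≃ₗ[R] R ⧸ q.asIdeal) →
        intervalRank (⊥ : Submodule R X) ⊤ < ω ^ (n + 1))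
    (X : Type v) [AddCommGroup X] [Module R X] [hX : Module.Finite R X]
    (hI : ∀ a ∈ I, ∀ x : X, a • x = 0) :
    intervalRank (⊥ : Submodule R X) ⊤ < ω ^ (n + 1) := by
  revert hI
  induction hX using IsNoetherianRing.induction_on_isQuotientEquivQuotientPrime R with
  | subsingleton N =>
    intro _
    rw [Subsingleton.elim (⊤ : Submodule R N) ⊥, intervalRank_self]
    exact omega0_pow_pos _
  | quotient N q e =>
    refine fun hI => h N q (fun a ha => ?_) e
    have := congrArg e (hI a ha (e.symm 1))
    rw [map_smul, e.apply_symm_apply, map_zero] at this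
    rw [← Ideal.Quotient.eq_zero_iff_mem, ← this, Algebra.smul_def, mul_one]
    rfl
  | exact N₁ N₂ N₃ f g hf hg hfg h₁ h₃ =>
    refine fun hI => intervalRank_lt_of_exact hf hg hfg (h₁ fun a ha x => hf ?_)
      (h₃ fun a ha x => ?_)
    · rw [map_smul, hI a ha, map_zero]
    · obtain ⟨y, rfl⟩ := hg x
      rw [← map_smul, hI a ha, map_zero]

theorem intervalRank_lt_of_coheight_lt (n : ℕ) (X : Type v) [AddCommGroup X] [Module R X]
    [Module.Finite R X] (p : PrimeSpectrum R) (hp : Order.coheight p < n)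
    (e : X ≃ₗ[R] R ⧸ p.asIdeal) : intervalRank (⊥ : Submodule R X) ⊤ < ω ^ (n + 1) := by
  induction n generalizing X p with
  | zero => simp at hp
  | succ n ih =>
    have hp' : Order.coheight p ≤ n := by
      rw [Nat.cast_add, Nat.cast_one] at hp
      exact Order.le_of_lt_add_one hp
    rw [Order.coheight_le_coe_iff] at hp'
    refine lt_of_le_of_lt ?_
      (pow_lt_pow_right₀ (one_lt_omega0 : (1 : Ordinal.{v}) < ω) (Nat.lt_succ_self (n + 1)))
    refine intervalRank_le_iff.2 fun c hc _ => ?_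
    obtain ⟨z, hz, hz0⟩ := Submodule.exists_mem_ne_zero_of_ne_bot hc.ne'
    obtain ⟨t, ht⟩ := Ideal.Quotient.mk_surjective (e z)
    have htp : t ∉ p.asIdeal := fun h => hz0 <| by
      rw [← Ideal.Quotient.eq_zero_iff_mem, ht] at h
      exact e.map_eq_zero_iff.1 h
    rw [intervalRank_quotient]
    refine intervalRank_lt_of_forall_prime (p.asIdeal ⊔ Ideal.span {t})
      (fun Y _ _ _ q hq e' => ?_) (X ⧸ c) fun a ha x => ?_
    · refine ih Y q (hp' q ?_) e'
      refine lt_of_le_of_ne (le_sup_left.trans hq) ?_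
      rintro rfl
      exact htp (hq (le_sup_right (a := p.asIdeal) (Ideal.mem_span_singleton_self t)))
    · obtain ⟨x, rfl⟩ := c.mkQ_surjective x
      rw [← map_smul, Submodule.mkQ_apply, Submodule.Quotient.mk_eq_zero]
      obtain ⟨w, hw⟩ := Ideal.Quotient.mk_surjective (e x)
      obtain ⟨b, hb, r, hr, rfl⟩ := Submodule.mem_sup.1 ha
      obtain ⟨s, rfl⟩ := Ideal.mem_span_singleton'.1 hr
      have hkey : (b + s * t) • x = (s * w) • z := e.injective <| by
        rw [map_smul, map_smul, ← hw, ← ht, Algebra.smul_def, Algebra.smul_def,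
          Ideal.Quotient.algebraMap_eq, ← map_mul, ← map_mul, Ideal.Quotient.eq]
        have : (b + s * t) * w - s * w * t = w * b := by ring
        rw [this]
        exact Ideal.mul_mem_left _ _ hb
      rw [hkey]
      exact c.smul_mem _ hz

theorem exists_intervalRank_lt_omega0_pow (hR : ringKrullDim R < ⊤) (X : Type v) [AddCommGroup X]
    [Module R X] [Module.Finite R X] : ∃ n : ℕ, intervalRank (⊥ : Submodule R X) ⊤ < ω ^ n := by
  obtain ⟨n, hn⟩ : ∃ n : ℕ, ∀ p : PrimeSpectrum R, Order.coheight p < n := by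
    rcases isEmpty_or_nonempty (PrimeSpectrum R) with h | ⟨⟨p₀⟩⟩
    · exact ⟨0, fun p => h.elim p⟩
    · have hle := fun p : PrimeSpectrum R => Order.coheight_le_krullDim p
      change Order.krullDim (PrimeSpectrum R) < ⊤ at hR
      generalize Order.krullDim (PrimeSpectrum R) = d at *
      induction d with
      | bot => exact absurd (hle p₀) (by simp)
      | coe d =>
        induction d with
        | top => exact absurd hR (lt_irrefl _)
        | coe k =>
          refine ⟨k + 1, fun p => ?_⟩
          have := WithBot.coe_le_coe.1 (hle p)
          exact this.trans_lt (by exact_mod_cast Nat.lt_succ_self k)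
  exact ⟨n + 1, intervalRank_lt_of_forall_prime ⊥
    (fun Y _ _ _ q _ e => intervalRank_lt_of_coheight_lt n Y q (hn q) e) X
    (by rintro _ rfl x; exact zero_smul R x)⟩

end Modules

theorem coeff_intervalRank_natCast {L : Type v} [PartialOrder L] [WellFoundedGT L] (a b : L)
    (e : ℕ) : CNF.coeff ω (intervalRank a b) e = rankCoeff e a b := by
  rw [coeff_omega0_eq, opow_natCast, rankCoeff]

theorem coeff_eq_zero_of_lt_omega0_pow {o e : Ordinal.{v}} {n : ℕ} (h : o < ω ^ n) (he : ω ≤ e) :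
    CNF.coeff ω o e = 0 := by
  refine CNF.coeff_eq_zero_of_lt (h.trans_le ?_)
  rw [← opow_natCast]
  exact opow_le_opow_right omega0_pos ((natCast_lt_omega0 n).le.trans he)

theorem intervalRank_inf_eq_coeffInf {L : Type v} [Lattice L] [IsModularLattice L]
    [WellFoundedGT L] {a b c t : L} (hab : a ≤ b) (hac : a ≤ c) (hbt : b ≤ t) (hct : c ≤ t) {n : ℕ}
    (hn : intervalRank a t < ω ^ n) (ht : IsBinaryOrdinal (intervalRank a t)) :
    intervalRank a (b ⊓ c) = coeffInf (intervalRank a b) (intervalRank a c) := by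
  have hcoeff : CNF.coeff ω (intervalRank a (b ⊓ c)) =
      Finsupp.zipWith min (min_self 0) (CNF.coeff ω (intervalRank a b))
        (CNF.coeff ω (intervalRank a c)) := by
    ext e
    rw [Finsupp.zipWith_apply]
    rcases lt_or_ge e ω with he | he
    · obtain ⟨e, rfl⟩ := lt_omega0.1 he
      simp only [coeff_intervalRank_natCast]
      have h1 : rankCoeff e a t ≤ 1 := by
        have := ht e
        rw [coeff_intervalRank_natCast] at this
        rcases this with h | h <;> simp [h]
      have hb := (rankCoeff_mono e hab hbt).trans h1
      have hinf := le_inf hab hac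
      apply le_antisymm
      · exact le_min (rankCoeff_mono e hinf inf_le_left) (rankCoeff_mono e hinf inf_le_right)
      · by_cases h0 : rankCoeff e a b = 0 ∨ rankCoeff e a c = 0
        · rcases h0 with h0 | h0 <;> simp [h0]
        · rw [not_or] at h0
          have := rankCoeff_inf_ne_zero hab hac hbt hct h1 h0.1 h0.2
          exact ((min_le_left _ _).trans hb).trans
            (Order.one_le_iff_pos.2 (pos_iff_ne_zero.2 this))
    · have hzero : ∀ d ≤ t, CNF.coeff ω (intervalRank a d) e = 0 := fun d hd =>
        coeff_eq_zero_of_lt_omega0_pow ((intervalRank_le_right hd).trans_lt hn) he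
      rw [hzero _ (inf_le_left.trans hbt), hzero _ hbt, hzero _ hct, min_self]
  rw [coeffInf, ← hcoeff, CNF.eval_coeff]

theorem coeffInf_self (o : Ordinal.{v}) : coeffInf o o = o := by
  have : Finsupp.zipWith min (min_self 0) (CNF.coeff ω o) (CNF.coeff ω o) = CNF.coeff ω o := by
    ext e
    rw [Finsupp.zipWith_apply, min_self]
  rw [coeffInf, this, CNF.eval_coeff]

section Modules

variable {R : Type u} {M : Type v} [CommRing R] [AddCommGroup M] [Module R M]

theorem intervalRank_span_singleton_eq [IsNoetherian R M] {x y : M}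
    (h : (⊥ : Submodule R M).colon {x} = (⊥ : Submodule R M).colon {y}) :
    intervalRank ⊥ (Submodule.span R {x}) = intervalRank ⊥ (Submodule.span R {y}) := by
  have hker : LinearMap.ker (LinearMap.toSpanSingleton R M x) =
      LinearMap.ker (LinearMap.toSpanSingleton R M y) := by
    ext r
    simpa [Submodule.mem_colon_singleton] using SetLike.ext_iff.1 h r
  rw [← LinearMap.range_toSpanSingleton, ← LinearMap.range_toSpanSingleton,
    ← intervalRank_bot_subtype (LinearMap.range (LinearMap.toSpanSingleton R M x)),
    ← intervalRank_bot_subtype (LinearMap.range (LinearMap.toSpanSingleton R M y))]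
  exact ((LinearMap.quotKerEquivRange _).symm.trans ((Submodule.quotEquivOfEq _ _ hker).trans
    (LinearMap.quotKerEquivRange _))).intervalRank_eq

theorem colon_singleton_eq_of_mem_span {p : Ideal R} [p.IsPrime] {x z : M}
    (hx : p = (⊥ : Submodule R M).colon {x}) (hz : z ∈ Submodule.span R {x}) (hz0 : z ≠ 0) :
    p = (⊥ : Submodule R M).colon {z} := by
  obtain ⟨r, rfl⟩ := Submodule.mem_span_singleton.1 hz
  have hmem : ∀ a : R, a ∈ p ↔ a • x = 0 := fun a => by
    rw [hx, Submodule.mem_colon_singleton, Submodule.mem_bot]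
  have hr : r ∉ p := fun h => hz0 ((hmem r).1 h)
  ext a
  rw [Submodule.mem_colon_singleton, Submodule.mem_bot, smul_smul, ← hmem]
  exact ⟨fun h => p.mul_mem_right r h,
    fun h => (Ideal.IsPrime.mem_or_mem ‹_› h).resolve_right hr⟩

theorem mem_associatedPrimes_submodule_iff [IsNoetherianRing R] {N : Submodule R M} {p : Ideal R} :
    p ∈ associatedPrimes R N ↔
      p.IsPrime ∧ ∃ x ∈ N, p = (⊥ : Submodule R M).colon {x} := by
  rw [AssociatedPrimes.mem_iff, isAssociatedPrime_iff]
  refine and_congr_right fun _ => ?_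
  have hcolon : ∀ x : N, (⊥ : Submodule R N).colon {x} = (⊥ : Submodule R M).colon {(x : M)} :=
    fun x => by
      ext a
      simp only [Submodule.mem_colon_singleton, Submodule.mem_bot]
      exact Subtype.ext_iff
  exact ⟨fun ⟨x, hx⟩ => ⟨x, x.2, hx.trans (hcolon x)⟩,
    fun ⟨x, hxN, hx⟩ => ⟨⟨x, hxN⟩, hx.trans (hcolon ⟨x, hxN⟩).symm⟩⟩

end Modules

theorem theoremT {R : Type u} {M : Type v} [CommRing R] [IsNoetherianRing R]
    (hR : ringKrullDim R < ⊤) [AddCommGroup M] [Module R M] [Module.Finite R M]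
    (hM : IsBinaryOrdinal (ordinalLength R M)) (N N' : Submodule R M) :
    ordinalLength R ↥(N ⊓ N') = coeffInf (ordinalLength R N) (ordinalLength R N') ∧
      associatedPrimes R ↥(N ⊓ N') = associatedPrimes R N ∩ associatedPrimes R N' := by
  obtain ⟨n, hn⟩ := exists_intervalRank_lt_omega0_pow hR M
  rw [ordinalLength_eq_intervalRank hn] at hM
  have hlen : ∀ P : Submodule R M, ordinalLength R P = intervalRank ⊥ P := fun P => by
    rw [← intervalRank_bot_subtype]
    refine ordinalLength_eq_intervalRank (n := n) ?_
    rw [intervalRank_bot_subtype]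
    exact (intervalRank_le_right le_top).trans_lt hn
  have hinf : ∀ P P' : Submodule R M,
      intervalRank ⊥ (P ⊓ P') = coeffInf (intervalRank ⊥ P) (intervalRank ⊥ P') := fun P P' =>
    intervalRank_inf_eq_coeffInf bot_le bot_le le_top le_top hn hM
  refine ⟨by rw [hlen, hlen, hlen, hinf], Set.Subset.antisymm ?_ ?_⟩
  · exact Set.subset_inter
      (associatedPrimes.subset_of_injective (Submodule.inclusion_injective inf_le_left))
      (associatedPrimes.subset_of_injective (Submodule.inclusion_injective inf_le_right))
  · rintro p ⟨hp, hp'⟩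
    rw [mem_associatedPrimes_submodule_iff] at hp hp' ⊢
    obtain ⟨hprime, x, hxN, hx⟩ := hp
    obtain ⟨-, y, hyN, hy⟩ := hp'
    refine ⟨hprime, ?_⟩
    have hrank := hinf (Submodule.span R {x}) (Submodule.span R {y})
    rw [← intervalRank_span_singleton_eq (hx.symm.trans hy), coeffInf_self] at hrank
    have hne : Submodule.span R {x} ⊓ Submodule.span R {y} ≠ ⊥ := fun h => by
      rw [h, intervalRank_self] at hrank
      have h0 := (intervalRank_eq_zero_iff bot_le).1 hrank.symm
      rw [eq_comm, Submodule.span_singleton_eq_bot] at h0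
      refine hprime.ne_top ((Ideal.eq_top_iff_one p).2 ?_)
      rw [hx, Submodule.mem_colon_singleton, h0, smul_zero]
      exact zero_mem _
    obtain ⟨z, ⟨hzx, hzy⟩, hz0⟩ := Submodule.exists_mem_ne_zero_of_ne_bot hne
    exact ⟨z, ⟨(Submodule.span_singleton_le_iff_mem x N).2 hxN hzx,
      (Submodule.span_singleton_le_iff_mem y N').2 hyN hzy⟩,
      colon_singleton_eq_of_mem_span hx hzx hz0⟩
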